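/- **Theorem 3.** Let $F$ be a field of characteristic different from $2$. All algebras below are (not necessarily associative or unital) $F$-algebras, and ideals are two-sided ideals that are $F$-subspaces. An algebra $A$ is a *Novikov algebra* if $(x,y,z)=(y,x,z)$ and $(xy)z=(xz)y$ for all $x,y,z\in A$, where $(x,y,z)=(xy)z-x(yz)$. It is *Lie-solvable* if $A^{(n)_L}=0$ for some $n\ge 0$, where $A^{(0)_L}=A$ and $A^{(n+1)_L}$ is the subspace spanned by all commutators $ab-ba$ with $a,b\in A^{(n)_L}$. An algebra $A$ is *left-quasiregular* if for every $x\in A$ there is $y\in A$ with $x+y=yx$; an ideal is called left-quasiregular if it is so as an algebra. The *heart* of an algebra is the intersection of all its nonzero ideals; an algebra is *subdirectly irreducible* if its heart $H$ is nonzero, and its heart is *idempotent* if $H^2=H$ (where $H^2$ is the span of all products of two elements of $H$). A Novikov algebra is *Andrunakievich-radical* ($\mathcal A$-radical) if it has no homomorphism onto a subdirectly irreducible Novikov algebra with idempotent heart; an ideal is called $\mathcal A$-radical if it is so as an algebra. Let $A$ be a Lie-solvable Novikov algebra over $F$. Then: 1. $A$ is left-quasiregular if and only if $A$ is $\mathcal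 A$-radical. Thus, in the class of Lie-solvable Novikov algebras, the left-quasiregular algebras are exactly the $\mathcal A$-radical algebras. 2. The sum $J(A)$ of all left-quasiregular ideals of $A$ is a left-quasiregular ideal, and the quotient algebra $A/J(A)$ has no nonzero left-quasiregular ideals. 3. $J(A)$ is the Andrunakievich radical of $A$, that is, the largest $\mathcal A$-radical ideal of $A$. -/

import Mathlib

universe u v

namespace NovikovRadicals

/-- Novikov algebras: the associator is left-symmetric and right multiplications commute. -/
def IsNovikov (A : Type u) [NonUnitalNonAssocRing A] : Prop :=
  (∀ x y z : A, associator x y z = associator y x z) ∧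
    ∀ x y z : A, (x * y) * z = (x * z) * y

/-- Every `x` has some `y` with `x + y = y x`. -/
def IsLeftQuasiregular (A : Type u) [NonUnitalNonAssocRing A] : Prop :=
  ∀ x : A, ∃ y : A, x + y = y * x

section Defs

variable (F : Type v) [Field F] (A : Type u) [NonUnitalNonAssocRing A] [Module F A]

/-- The Lie-solvable powers: the whole algebra, then repeatedly the subspace spanned by all
commutators of elements of the previous term. -/
def liePower : ℕ → Submodule F A
  | 0 => ⊤
  | n + 1 => Submodule.span F
      {c : A | ∃ a ∈ liePower n, ∃ b ∈ liePower n, c = a * b - b * a}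

/-- Some Lie-solvable power vanishes. -/
def IsLieSolvable : Prop := ∃ n : ℕ, liePower F A n = ⊥

/-- Two-sided ideals of the `F`-algebra `A`: subspaces absorbing multiplication on both sides. -/
structure AlgIdeal extends Submodule F A where
  mul_mem_left : ∀ (a : A) {x : A}, x ∈ toSubmodule → a * x ∈ toSubmodule
  mul_mem_right : ∀ (a : A) {x : A}, x ∈ toSubmodule → x * a ∈ toSubmodule

/-- The heart: the intersection of all nonzero ideals. -/
def heart : Submodule F A :=
  sInf {H : Submodule F A | ∃ I : AlgIdeal F A, I.toSubmodule ≠ ⊥ ∧ H = I.toSubmodule}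

/-- The heart is nonzero (in the zero algebra the intersection is the zero algebra itself, so the
zero algebra is not subdirectly irreducible). -/
def IsSubdirectlyIrreducible : Prop := heart F A ≠ ⊥

/-- The heart `H` satisfies `H * H = H`, where `H * H` is spanned by all products. -/
def HasIdempotentHeart : Prop :=
  Submodule.span F {c : A | ∃ a ∈ heart F A, ∃ b ∈ heart F A, c = a * b} = heart F A

/-- The subdirectly irreducible Novikov algebras with idempotent heart. -/
def IsIrreducibleWithIdempotentHeart : Prop :=
  IsNovikov A ∧ IsSubdirectlyIrreducible F A ∧ HasIdempotentHeart F A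

/-- Andrunakievich-radical Novikov algebras: those without a surjective homomorphism onto a
subdirectly irreducible Novikov algebra with idempotent heart. A homomorphic image of `A` always
has a copy in the universe of `A`. -/
def IsAndrunakievichRadical : Prop :=
  IsNovikov A ∧
    ∀ (B : Type u) [NonUnitalNonAssocRing B] [Module F B] [IsScalarTower F B B]
      [SMulCommClass F B B] (f : A →ₙₐ[F] B),
      Function.Surjective f → ¬ IsIrreducibleWithIdempotentHeart F B

end Defs

section Ideals

variable {F : Type v} [Field F] {A : Type u} [NonUnitalNonAssocRing A] [Module F A]

/-- An ideal as an algebra in its own right. -/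
def AlgIdeal.toSubalgebra (I : AlgIdeal F A) : NonUnitalSubalgebra F A :=
  { I.toSubmodule with
    mul_mem' := fun {a _} _ hb => I.mul_mem_left a hb }

/-- The quotient algebra of `A` by an ideal. -/
def AlgIdeal.Quotient (I : AlgIdeal F A) : Type u := A ⧸ I.toSubmodule

instance (I : AlgIdeal F A) : AddCommGroup I.Quotient :=
  inferInstanceAs (AddCommGroup (A ⧸ I.toSubmodule))

instance (I : AlgIdeal F A) : Module F I.Quotient :=
  inferInstanceAs (Module F (A ⧸ I.toSubmodule))

/-- The class of an element in the quotient algebra. -/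
def AlgIdeal.proj (I : AlgIdeal F A) : A →ₗ[F] I.Quotient := I.toSubmodule.mkQ

theorem AlgIdeal.proj_surjective (I : AlgIdeal F A) : Function.Surjective I.proj :=
  Submodule.mkQ_surjective _

theorem AlgIdeal.proj_eq_proj_iff (I : AlgIdeal F A) (a b : A) :
    I.proj a = I.proj b ↔ a - b ∈ I.toSubmodule :=
  Submodule.Quotient.eq _

instance (I : AlgIdeal F A) : Mul I.Quotient :=
  ⟨Quotient.map₂ (· * ·) (by
    intro a a' h b b' h'
    have h1 : a - a' ∈ I.toSubmodule := (Submodule.quotientRel_def _).1 h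
    have h2 : b - b' ∈ I.toSubmodule := (Submodule.quotientRel_def _).1 h'
    refine (Submodule.quotientRel_def _).2 ?_
    have e : a * b - a' * b' = (a - a') * b + a' * (b - b') := by
      rw [sub_mul, mul_sub]; abel
    rw [e]
    exact I.toSubmodule.add_mem (I.mul_mem_right _ h1) (I.mul_mem_left _ h2))⟩

theorem AlgIdeal.proj_mul (I : AlgIdeal F A) (a b : A) : I.proj (a * b) = I.proj a * I.proj b := rfl

instance (I : AlgIdeal F A) : NonUnitalNonAssocRing I.Quotient :=
  { (inferInstance : AddCommGroup I.Quotient), (inferInstance : Mul I.Quotient) with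
    left_distrib := by
      intro a b c
      obtain ⟨a, rfl⟩ := I.proj_surjective a
      obtain ⟨b, rfl⟩ := I.proj_surjective b
      obtain ⟨c, rfl⟩ := I.proj_surjective c
      simp only [← map_add, ← AlgIdeal.proj_mul, mul_add]
    right_distrib := by
      intro a b c
      obtain ⟨a, rfl⟩ := I.proj_surjective a
      obtain ⟨b, rfl⟩ := I.proj_surjective b
      obtain ⟨c, rfl⟩ := I.proj_surjective c
      simp only [← map_add, ← AlgIdeal.proj_mul, add_mul]
    zero_mul := by
      intro a
      obtain ⟨a, rfl⟩ := I.proj_surjective a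
      rw [← map_zero I.proj, ← AlgIdeal.proj_mul, zero_mul]
    mul_zero := by
      intro a
      obtain ⟨a, rfl⟩ := I.proj_surjective a
      rw [← map_zero I.proj, ← AlgIdeal.proj_mul, mul_zero] }

instance [IsScalarTower F A A] (I : AlgIdeal F A) : IsScalarTower F I.Quotient I.Quotient :=
  ⟨by
    intro c a b
    obtain ⟨a, rfl⟩ := I.proj_surjective a
    obtain ⟨b, rfl⟩ := I.proj_surjective b
    simp only [smul_eq_mul, ← map_smul, ← AlgIdeal.proj_mul, smul_mul_assoc]⟩

instance [SMulCommClass F A A] (I : AlgIdeal F A) : SMulCommClass F I.Quotient I.Quotient :=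
  ⟨by
    intro c a b
    obtain ⟨a, rfl⟩ := I.proj_surjective a
    obtain ⟨b, rfl⟩ := I.proj_surjective b
    simp only [smul_eq_mul, ← map_smul, ← AlgIdeal.proj_mul, mul_smul_comm]⟩

variable (F A)

/-- The sum of all left-quasiregular ideals. -/
def quasiregularRadical : AlgIdeal F A where
  toSubmodule :=
    sSup {S : Submodule F A | ∃ I : AlgIdeal F A,
      IsLeftQuasiregular I.toSubalgebra ∧ S = I.toSubmodule}
  mul_mem_left := by
    intro a x hx
    rw [sSup_eq_iSup'] at hx ⊢
    refine Submodule.iSup_induction _ (motive := fun x => a * x ∈ _) hx ?_ ?_ ?_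
    · rintro ⟨S, I, hI, rfl⟩ x hx
      exact Submodule.mem_iSup_of_mem (⟨I.toSubmodule, I, hI, rfl⟩ :
        {S : Submodule F A | ∃ I : AlgIdeal F A,
          IsLeftQuasiregular I.toSubalgebra ∧ S = I.toSubmodule}) (I.mul_mem_left a hx)
    · rw [mul_zero]; exact Submodule.zero_mem _
    · intro x y hx hy
      rw [mul_add]; exact Submodule.add_mem _ hx hy
  mul_mem_right := by
    intro a x hx
    rw [sSup_eq_iSup'] at hx ⊢
    refine Submodule.iSup_induction _ (motive := fun x => x * a ∈ _) hx ?_ ?_ ?_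
    · rintro ⟨S, I, hI, rfl⟩ x hx
      exact Submodule.mem_iSup_of_mem (⟨I.toSubmodule, I, hI, rfl⟩ :
        {S : Submodule F A | ∃ I : AlgIdeal F A,
          IsLeftQuasiregular I.toSubalgebra ∧ S = I.toSubmodule}) (I.mul_mem_right a hx)
    · rw [zero_mul]; exact Submodule.zero_mem _
    · intro x y hx hy
      rw [add_mul]; exact Submodule.add_mem _ hx hy

end Ideals

end NovikovRadicals

namespace NovikovRadicals

/-! ### Commutator identities in Novikov algebras -/

section Basics

variable {A : Type u} [NonUnitalNonAssocRing A]

/-! Everything turns on the commutator ideal C, `liePower F A 1`. As 2 is invertible, all Lie powers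
are ideals, and Lie-solvability makes C right nilpotent (`isRightNilpotent_liePower_one`). Hence c ↦
c - c * x reaches all of C whenever x is quasiregular modulo C on both sides
(`IsNovikov.exists_eq_sub_mul`), so quasiregularity lifts from the commutative quotient A / C.

An idempotent heart cannot lie in a right nilpotent ideal. A Lie-solvable subdirectly irreducible B
with idempotent heart is therefore commutative, hence associative, and its heart contains e with h *
e = h ≠ 0 for some h. Such an e is not quasiregular, so left-quasiregular ideals vanish in every
such image B (`map_eq_zero_of_quasiregular`). Conversely, if x is not quasiregular modulo C, then C
together with all b - b * x forms an ideal missing x; an ideal maximal among those containing it and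
missing x has a quotient that equals its own idempotent heart.

Closure under sums and extensions is then proved on the Andrunakievich side, where it only concerns
what homomorphisms kill. -/

theorem IsNovikov.left_symm (h : IsNovikov A) (x y z : A) :
    (x * y) * z - x * (y * z) = (y * x) * z - y * (x * z) := h.1 x y z

theorem IsNovikov.right_comm (h : IsNovikov A) (x y z : A) : (x * y) * z = (x * z) * y :=
  h.2 x y z

theorem IsNovikov.two_commutator_mul (h : IsNovikov A) (a b c : A) :
    (a * b - b * a) * c + (a * b - b * a) * c =
      ((a * c) * b - b * (a * c)) + (a * (b * c) - (b * c) * a) := by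
  have h1 := h.left_symm a b c
  have h2 := h.right_comm a b c
  have h3 := h.right_comm b a c
  rw [sub_mul]
  linear_combination (norm := abel) h1 + h2 - h3

theorem IsNovikov.jacobi (h : IsNovikov A) (c a b : A) :
    c * (a * b - b * a) = (a * b - b * a) * c
      + (((c * a - a * c) * b - b * (c * a - a * c))
      + (a * (c * b - b * c) - (c * b - b * c) * a)) := by
  have h1 := h.left_symm c a b
  have h2 := h.left_symm c b a
  have h3 := h.left_symm a b c
  simp only [sub_mul, mul_sub]
  linear_combination (norm := abel) - h1 + h2 - h3

end Basics

/-! ### Lie powers as ideals -/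

section Ideals

variable {F : Type v} [Field F] {A : Type u} [NonUnitalNonAssocRing A] [Module F A]

/-- A subspace absorbing multiplication on both sides. -/
structure IsTwoSided (S : Submodule F A) : Prop where
  left : ∀ (a : A) {x : A}, x ∈ S → a * x ∈ S
  right : ∀ (a : A) {x : A}, x ∈ S → x * a ∈ S

/-- The ideal with a given underlying two-sided subspace. -/
def IsTwoSided.toAlgIdeal {S : Submodule F A} (h : IsTwoSided S) : AlgIdeal F A :=
  { S with mul_mem_left := h.left, mul_mem_right := h.right }

theorem heart_isTwoSided : IsTwoSided (heart F A) where
  left a x hx := by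
    simp only [heart, Submodule.mem_sInf] at hx ⊢
    rintro S ⟨I, hI, rfl⟩
    exact I.mul_mem_left a (hx _ ⟨I, hI, rfl⟩)
  right a x hx := by
    simp only [heart, Submodule.mem_sInf] at hx ⊢
    rintro S ⟨I, hI, rfl⟩
    exact I.mul_mem_right a (hx _ ⟨I, hI, rfl⟩)

theorem IsTwoSided.heart_le {S : Submodule F A} (h : IsTwoSided S) (hS : S ≠ ⊥) :
    heart F A ≤ S :=
  sInf_le ⟨h.toAlgIdeal, hS, rfl⟩

theorem commutator_mem_liePower_succ {n : ℕ} {a b : A} (ha : a ∈ liePower F A n)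
    (hb : b ∈ liePower F A n) : a * b - b * a ∈ liePower F A (n + 1) :=
  Submodule.subset_span ⟨a, ha, b, hb, rfl⟩

theorem commutator_mem_liePower_one (a b : A) : a * b - b * a ∈ liePower F A 1 :=
  commutator_mem_liePower_succ (n := 0) (Submodule.mem_top (R := F)) (Submodule.mem_top (R := F))

theorem mem_of_add_self_mem (hF : ringChar F ≠ 2) {S : Submodule F A} {x : A} (hx : x + x ∈ S) :
    x ∈ S := by
  have h2 : (2 : F) ≠ 0 := Ring.two_ne_zero hF
  rw [← two_smul F x] at hx
  exact (S.smul_mem_iff h2).1 hx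

variable [IsScalarTower F A A] [SMulCommClass F A A]

theorem liePower_isTwoSided (hF : ringChar F ≠ 2) (hN : IsNovikov A) (n : ℕ) :
    IsTwoSided (liePower F A n) := by
  induction n with
  | zero => exact ⟨fun _ _ _ => Submodule.mem_top (R := F), fun _ _ _ => Submodule.mem_top (R := F)⟩
  | succ n ih =>
    -- Twice [a, b] c is [ac, b] + [a, bc]; this is where characteristic 2 is excluded.
    have key : ∀ c, ∀ a ∈ liePower F A n, ∀ b ∈ liePower F A n,
        (a * b - b * a) * c ∈ liePower F A (n + 1) := fun c a ha b hb => by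
      apply mem_of_add_self_mem hF
      rw [hN.two_commutator_mul]
      exact add_mem (commutator_mem_liePower_succ (ih.right c ha) hb)
        (commutator_mem_liePower_succ ha (ih.right c hb))
    constructor
    · intro c x hx
      refine Submodule.span_induction (p := fun x _ => c * x ∈ liePower F A (n + 1))
        ?_ ?_ ?_ ?_ hx
      · rintro _ ⟨a, ha, b, hb, rfl⟩
        rw [hN.jacobi]
        exact add_mem (key c a ha b hb) (add_mem
          (commutator_mem_liePower_succ (sub_mem (ih.left c ha) (ih.right c ha)) hb)
          (commutator_mem_liePower_succ ha (sub_mem (ih.left c hb) (ih.right c hb))))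
      · rw [mul_zero]; exact zero_mem _
      · intro x y _ _ hx hy; rw [mul_add]; exact add_mem hx hy
      · intro r x _ hx; rw [mul_smul_comm]; exact Submodule.smul_mem _ r hx
    · intro c x hx
      refine Submodule.span_induction (p := fun x _ => x * c ∈ liePower F A (n + 1))
        ?_ ?_ ?_ ?_ hx
      · rintro _ ⟨a, ha, b, hb, rfl⟩
        exact key c a ha b hb
      · rw [zero_mul]; exact zero_mem _
      · intro x y _ _ hx hy; rw [add_mul]; exact add_mem hx hy
      · intro r x _ hx; rw [smul_mul_assoc]; exact Submodule.smul_mem _ r hx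

/-! ### Products of ideals and right powers -/

/-- The span of all products of an element of `S` and an element of `T`. -/
def prodSpan (S T : Submodule F A) : Submodule F A := Submodule.map₂ (LinearMap.mul F A) S T

theorem mul_mem_prodSpan {S T : Submodule F A} {a b : A} (ha : a ∈ S) (hb : b ∈ T) :
    a * b ∈ prodSpan S T :=
  Submodule.apply_mem_map₂ (LinearMap.mul F A) ha hb

theorem prodSpan_le {S T U : Submodule F A} :
    prodSpan S T ≤ U ↔ ∀ a ∈ S, ∀ b ∈ T, a * b ∈ U :=
  Submodule.map₂_le

theorem prodSpan_mono {S S' T T' : Submodule F A} (hS : S ≤ S') (hT : T ≤ T') :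
    prodSpan S T ≤ prodSpan S' T' :=
  Submodule.map₂_le_map₂ hS hT

theorem IsTwoSided.prodSpan (hN : IsNovikov A) {S T : Submodule F A} (hS : IsTwoSided S)
    (hT : IsTwoSided T) : IsTwoSided (prodSpan S T) where
  left c x hx := by
    have : NovikovRadicals.prodSpan S T ≤
        (NovikovRadicals.prodSpan S T).comap (LinearMap.mulLeft F c) := by
      refine prodSpan_le.2 fun a ha b hb => ?_
      have h := hN.left_symm c a b
      have e : c * (a * b) = (c * a) * b - (a * c) * b + a * (c * b) := by
        linear_combination (norm := abel) -h
      rw [Submodule.mem_comap, LinearMap.mulLeft_apply, e]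
      exact add_mem (sub_mem (mul_mem_prodSpan (hS.left c ha) hb)
        (mul_mem_prodSpan (hS.right c ha) hb)) (mul_mem_prodSpan ha (hT.left c hb))
    exact this hx
  right c x hx := by
    have : NovikovRadicals.prodSpan S T ≤
        (NovikovRadicals.prodSpan S T).comap (LinearMap.mulRight F c) := by
      refine prodSpan_le.2 fun a ha b hb => ?_
      rw [Submodule.mem_comap, LinearMap.mulRight_apply, hN.right_comm]
      exact mul_mem_prodSpan (hS.right c ha) hb
    exact this hx

/-- The right powers `K`, `K K`, `(K K) K`, … of a subspace. -/
def rightPower (K : Submodule F A) : ℕ → Submodule F A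
  | 0 => K
  | n + 1 => prodSpan (rightPower K n) K

/-- Some right power vanishes. -/
def IsRightNilpotent (K : Submodule F A) : Prop := ∃ n, rightPower K n = ⊥

theorem rightPower_mono {K L : Submodule F A} (h : K ≤ L) (n : ℕ) :
    rightPower K n ≤ rightPower L n := by
  induction n with
  | zero => exact h
  | succ n ih => exact prodSpan_mono ih h

theorem IsRightNilpotent.mono {K L : Submodule F A} (h : K ≤ L) (hL : IsRightNilpotent L) :
    IsRightNilpotent K := by
  obtain ⟨n, hn⟩ := hL
  exact ⟨n, le_bot_iff.1 (hn ▸ rightPower_mono h n)⟩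

theorem IsTwoSided.rightPower (hN : IsNovikov A) {K : Submodule F A} (hK : IsTwoSided K) (n : ℕ) :
    IsTwoSided (rightPower K n) := by
  induction n with
  | zero => exact hK
  | succ n ih => exact ih.prodSpan hN hK

/-- Left multiplication by `K * K` maps each right power of `K` into the next one. -/
theorem sq_mul_mem_rightPower_succ (hN : IsNovikov A) {K : Submodule F A} (hK : IsTwoSided K)
    {n : ℕ} {d m : A} (hd : d ∈ prodSpan K K) (hm : m ∈ rightPower K n) :
    d * m ∈ rightPower K (n + 1) := by
  have : prodSpan K K ≤ (rightPower K (n + 1)).comap (LinearMap.mulRight F m) := by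
    refine prodSpan_le.2 fun a _ b hb => ?_
    rw [Submodule.mem_comap, LinearMap.mulRight_apply, hN.right_comm]
    exact mul_mem_prodSpan ((hK.rightPower hN n).left a hm) hb
  exact this hd

/-- Left symmetry rewrites (k x) y as (x k) y - x (k y) + k (x y); right commutativity then pairs
the factors from I into elements of I I, on one side or the other of the factor from the right
power. -/
theorem triple_mul_mem (hN : IsNovikov A) {I : Submodule F A} (hI : IsTwoSided I) {n : ℕ}
    {k x y z : A} (hk : k ∈ rightPower (prodSpan I I) n) (hx : x ∈ I) (hy : y ∈ I) (hz : z ∈ I) :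
    ((k * x) * y) * z ∈ prodSpan (prodSpan I I) (rightPower (prodSpan I I) n) ⊔
      rightPower (prodSpan I I) (n + 1) := by
  have hK := hI.prodSpan hN hI
  have hKn := hK.rightPower hN n
  have e : ((k * x) * y) * z =
      ((x * y) * k) * z - (x * z) * (k * y) + (k * (x * y)) * z := by
    have h1 := congrArg (· * z) (hN.left_symm k x y)
    have h2 := congrArg (· * z) (hN.right_comm x k y)
    have h3 := hN.right_comm x (k * y) z
    simp only [sub_mul] at h1 h2
    linear_combination (norm := abel) h1 + h2 - h3
  rw [e]
  refine add_mem (Submodule.mem_sup_left (sub_mem ?_ ?_)) (Submodule.mem_sup_right ?_)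
  · exact (hK.prodSpan hN hKn).right z (mul_mem_prodSpan (mul_mem_prodSpan hx hy) hk)
  · exact mul_mem_prodSpan (mul_mem_prodSpan hx hz) (hKn.right y hk)
  · exact (hK.rightPower hN (n + 1)).right z (mul_mem_prodSpan hk (mul_mem_prodSpan hx hy))

theorem triple_mul_prod_mem (hN : IsNovikov A) {I : Submodule F A} (hI : IsTwoSided I) {n : ℕ}
    {t x y z : A} (ht : t ∈ prodSpan (prodSpan I I) (rightPower (prodSpan I I) n) ⊔
      rightPower (prodSpan I I) (n + 1)) (hx : x ∈ I) (hy : y ∈ I) (hz : z ∈ I) :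
    ((t * x) * y) * z ∈ rightPower (prodSpan I I) (n + 1) := by
  have hK := hI.prodSpan hN hI
  have hKn := hK.rightPower hN (n + 1)
  have key : prodSpan (prodSpan I I) (rightPower (prodSpan I I) n) ⊔
      rightPower (prodSpan I I) (n + 1) ≤ (rightPower (prodSpan I I) (n + 1)).comap
        ((LinearMap.mulRight F z).comp ((LinearMap.mulRight F y).comp
          (LinearMap.mulRight F x))) := by
    refine sup_le (prodSpan_le.2 fun k hk m hm => ?_) fun t ht =>
      hKn.right z (hKn.right y (hKn.right x ht))
    simp only [Submodule.mem_comap, LinearMap.comp_apply, LinearMap.mulRight_apply]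
    -- With m moved to the far right, the previous lemma at n = 0 puts k x y z in K K, for K = I I,
    -- and left multiplication by K K raises the right power of m.
    rw [hN.right_comm k m x, hN.right_comm _ m y, hN.right_comm _ m z]
    have h := triple_mul_mem (n := 0) hN hI hk hx hy hz
    exact sq_mul_mem_rightPower_succ hN hK ((sup_le le_rfl le_rfl :
      prodSpan (prodSpan I I) (rightPower (prodSpan I I) 0) ⊔
        rightPower (prodSpan I I) 1 ≤ prodSpan (prodSpan I I) (prodSpan I I)) h) hm
  exact key ht

theorem IsRightNilpotent.of_sq (hN : IsNovikov A) {I : Submodule F A} (hI : IsTwoSided I)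
    (h : IsRightNilpotent (prodSpan I I)) : IsRightNilpotent I := by
  obtain ⟨n, hn⟩ := h
  have three : ∀ {S U : Submodule F A}, (∀ s ∈ S, ∀ x ∈ I, ∀ y ∈ I, ∀ z ∈ I,
      ((s * x) * y) * z ∈ U) → prodSpan (prodSpan (prodSpan S I) I) I ≤ U := by
    intro S U h
    refine prodSpan_le.2 fun a ha z hz => ?_
    have h2 : prodSpan (prodSpan S I) I ≤ U.comap (LinearMap.mulRight F z) := by
      refine prodSpan_le.2 fun b hb y hy => ?_
      have h1 : prodSpan S I ≤ U.comap ((LinearMap.mulRight F z).comp (LinearMap.mulRight F y)) :=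
        prodSpan_le.2 fun s hs x hx => h s hs x hx y hy z hz
      exact h1 hb
    exact h2 ha
  -- Indices start at zero, so index 1 for I already equals index 0 for I I; each further step costs
  -- three factors from I, used twice.
  have key : ∀ i, rightPower I (1 + 6 * i) ≤ rightPower (prodSpan I I) i := by
    intro i
    induction i with
    | zero => exact le_rfl
    | succ i ih =>
      have e1 : rightPower I (1 + 6 * i + 3) ≤
          prodSpan (prodSpan I I) (rightPower (prodSpan I I) i) ⊔
            rightPower (prodSpan I I) (i + 1) :=
        three fun s hs x hx y hy z hz => triple_mul_mem hN hI (ih hs) hx hy hz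
      have e2 : rightPower I (1 + 6 * i + 3 + 3) ≤ rightPower (prodSpan I I) (i + 1) :=
        three fun s hs x hx y hy z hz => triple_mul_prod_mem hN hI (e1 hs) hx hy hz
      exact e2
  exact ⟨1 + 6 * n, le_bot_iff.1 (hn ▸ key n)⟩

/-! ### Right nilpotency of the commutator ideal -/

theorem associator_mem_liePower (hF : ringChar F ≠ 2) (hN : IsNovikov A) {n : ℕ} {p q : A}
    (hp : p ∈ liePower F A n) (hq : q ∈ liePower F A n) (b : A) :
    (p * q) * b - p * (q * b) ∈ liePower F A (n + 1) := by
  have e : (p * q) * b - p * (q * b) = (p * q - q * p) * b - (p * (q * b) - (q * b) * p) := by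
    have h := hN.right_comm q b p
    rw [sub_mul]
    linear_combination (norm := abel) -h
  rw [e]
  exact sub_mem ((liePower_isTwoSided hF hN (n + 1)).right b (commutator_mem_liePower_succ hp hq))
    (commutator_mem_liePower_succ hp ((liePower_isTwoSided hF hN n).right b hq))

theorem IsNovikov.associator_mul_left_comm (hN : IsNovikov A) (i j a b : A) :
    ((i * j) * a) * b - (i * j) * (a * b) = ((a * j) * i) * b - (a * j) * (i * b) := by
  have h := congrArg (· * j) (hN.left_symm i a b)
  simp only [sub_mul] at h
  rw [hN.right_comm i j a, hN.right_comm _ j b, hN.right_comm i j, hN.right_comm a j i,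
    hN.right_comm _ j b, hN.right_comm a j]
  exact h

/-- The product (i j) [a, b] is a difference of two associators, (b j, i, a) - (a j, i, b), whose
first two entries lie in the ideal; such associators fall into the next Lie power. -/
theorem sq_prod_le (hF : ringChar F ≠ 2) (hN : IsNovikov A) (n : ℕ) :
    prodSpan (prodSpan (liePower F A (n + 1)) (liePower F A (n + 1))) (liePower F A (n + 1)) ≤
      liePower F A (n + 2) := by
  have hI := liePower_isTwoSided (A := A) hF hN (n + 1)
  refine prodSpan_le.2 fun d hd c hc => ?_
  have h1 : prodSpan (liePower F A (n + 1)) (liePower F A (n + 1)) ≤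
      (liePower F A (n + 2)).comap (LinearMap.mulRight F c) := by
    refine prodSpan_le.2 fun i hi j hj => ?_
    have h2 : liePower F A (n + 1) ≤
        (liePower F A (n + 2)).comap (LinearMap.mulLeft F (i * j)) := by
      refine Submodule.span_le.2 ?_
      rintro _ ⟨a, _, b, _, rfl⟩
      change (i * j) * (a * b - b * a) ∈ liePower F A (n + 2)
      have e : (i * j) * (a * b - b * a) = (((b * j) * i) * a - (b * j) * (i * a)) -
          (((a * j) * i) * b - (a * j) * (i * b)) := by
        rw [← hN.associator_mul_left_comm i j b a, ← hN.associator_mul_left_comm i j a b,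
          hN.right_comm (i * j) b a, mul_sub]
        abel
      rw [e]
      exact sub_mem (associator_mem_liePower hF hN (hI.left b hj) hi a)
        (associator_mem_liePower hF hN (hI.left a hj) hi b)
    exact h2 hc
  exact h1 hd

/-- The commutator ideal of a Lie-solvable Novikov algebra is right nilpotent. -/
theorem isRightNilpotent_liePower_one (hF : ringChar F ≠ 2) (hN : IsNovikov A)
    (hL : IsLieSolvable F A) : IsRightNilpotent (liePower F A 1) := by
  obtain ⟨n, hn⟩ := hL
  have base : IsRightNilpotent (liePower F A (n + 1)) := by
    refine ⟨0, ?_⟩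
    refine (Submodule.span_eq_bot.2 ?_ : liePower F A (n + 1) = ⊥)
    rintro _ ⟨a, ha, b, hb, rfl⟩
    rw [hn, Submodule.mem_bot] at ha
    rw [ha, zero_mul, mul_zero, sub_zero]
  clear hn
  induction n with
  | zero => exact base
  | succ n ih =>
    have hI := liePower_isTwoSided hF hN (n + 1)
    -- Descend one Lie power: (I I)(I I) ≤ (I I) I lies in the next one, so two square roots recover
    -- I.
    exact ih (.of_sq hN hI (.of_sq hN (hI.prodSpan hN hI) (base.mono
      ((prodSpan_mono le_rfl (prodSpan_le.2 fun _ ha b _ => hI.right b ha)).trans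
        (sq_prod_le hF hN n)))))

/-! ### Lifting quasiregularity along a right nilpotent ideal -/

theorem IsNovikov.exists_sub_mul_mem (hN : IsNovikov A) {C : Submodule F A} (hC : IsTwoSided C)
    {x y : A} (hz : x + y - y * x ∈ C) (hz' : x + y - x * y ∈ C) {n : ℕ} {m : A}
    (hm : m ∈ rightPower C n) :
    ∃ m' ∈ rightPower C n, m - (m' - m' * x) ∈
      prodSpan C (rightPower C n) ⊔ rightPower C (n + 1) := by
  have hn := hC.rightPower hN n
  have hCn := hC.prodSpan hN hn
  have hu : m - m * x ∈ rightPower C n := sub_mem hm (hn.right x hm)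
  set u := m - m * x with hu_def
  set w := y * u with hw
  have hw_mem : w ∈ rightPower C n := hn.left y hu
  -- Let P a = a - a x and z = x + y - y x. Left symmetry gives P (m - m y + y m) = m - m z + w, and
  -- P (w - w y) cancels w up to the products of z and x + y - x y with u.
  refine ⟨(m - m * y) + y * m - (w - w * y), sub_mem (add_mem (sub_mem hm (hn.right y hm))
    (hn.left y hm)) (sub_mem hw_mem (hn.right y hw_mem)), ?_⟩
  have e : m - (((m - m * y) + y * m - (w - w * y)) - ((m - m * y) + y * m - (w - w * y)) * x) =
      (((x + y - y * x) * u - ((x + y - y * x) * u) * y) - (x + y - x * y) * u)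
        + m * (x + y - y * x) := by
    have h1 := hN.left_symm m y x
    have h2 := hN.right_comm x y u
    have h3 := hN.right_comm y x u
    have h4 := congrArg (· * y) h3
    have h5 := hN.right_comm w x y
    have h6 : y * u = y * m - y * (m * x) := by rw [hu_def, mul_sub]
    rw [← hw] at h3 h4 h6
    simp only [sub_mul, add_mul, mul_add, mul_sub, ← hw]
    linear_combination (norm := abel) - h1 - h2 + h3 - h4 - h5 + h6
  rw [e]
  have hzu := mul_mem_prodSpan hz hu
  exact add_mem (Submodule.mem_sup_left (sub_mem (sub_mem hzu (hCn.right y hzu))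
    (mul_mem_prodSpan hz' hu))) (Submodule.mem_sup_right (mul_mem_prodSpan hm hz))

/-- On a right nilpotent ideal, `c ↦ c - c * x` is surjective when `x` is quasiregular modulo
the ideal. -/
theorem IsNovikov.exists_eq_sub_mul (hN : IsNovikov A) {C : Submodule F A} (hC : IsTwoSided C)
    (hnil : IsRightNilpotent C) {x y : A} (hz : x + y - y * x ∈ C) (hz' : x + y - x * y ∈ C)
    {c : A} (hc : c ∈ C) : ∃ c', c = c' - c' * x := by
  set P : A →ₗ[F] A := LinearMap.id - LinearMap.mulRight F x with hP
  have hPa : ∀ a, P a = a - a * x := fun a => rfl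
  have step : ∀ n, rightPower C n ≤
      (rightPower C n).map P ⊔ (prodSpan C (rightPower C n) ⊔ rightPower C (n + 1)) := by
    intro n m hm
    obtain ⟨m', hm', h⟩ := hN.exists_sub_mul_mem hC hz hz' hm
    rw [← add_sub_cancel (m' - m' * x) m]
    exact Submodule.add_mem_sup ⟨m', hm', rfl⟩ h
  have step' : ∀ n, rightPower C n ≤ LinearMap.range P ⊔ rightPower C (n + 1) := by
    intro n
    refine (step n).trans (sup_le ((LinearMap.map_le_range).trans le_sup_left)
      (sup_le (prodSpan_le.2 fun c hc m hm => ?_) le_sup_right))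
    -- At n = 0 both error terms are C C. Since P commutes with right multiplication by m, only an
    -- element of (C C) m escapes the range, and it lies in the next right power.
    have h0 : c ∈ C.map P ⊔ prodSpan C C :=
      (step 0).trans (sup_le_sup_left (sup_le le_rfl le_rfl) _) hc
    obtain ⟨_, ⟨c', hc', rfl⟩, d, hd, rfl⟩ := Submodule.mem_sup.1 h0
    rw [add_mul]
    refine Submodule.add_mem_sup ⟨c' * m, ?_⟩ (sq_mul_mem_rightPower_succ hN hC hd hm)
    rw [hPa, hPa, sub_mul, hN.right_comm c' m x]
  have all : ∀ n, C ≤ LinearMap.range P ⊔ rightPower C n := by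
    intro n
    induction n with
    | zero => exact le_sup_right
    | succ n ih => exact ih.trans (sup_le le_sup_left (step' n))
  obtain ⟨n, hn⟩ := hnil
  have := all n hc
  rw [hn, sup_bot_eq] at this
  obtain ⟨c', h⟩ := this
  exact ⟨c', h.symm⟩

theorem isLeftQuasiregular_of_mod_liePower_one (hF : ringChar F ≠ 2) (hN : IsNovikov A)
    (hL : IsLieSolvable F A) (h : ∀ x : A, ∃ y : A, x + y - y * x ∈ liePower F A 1) :
    IsLeftQuasiregular A := by
  intro x
  obtain ⟨y, hy⟩ := h x
  have hy' : x + y - x * y ∈ liePower F A 1 := by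
    have e : x + y - x * y = (x + y - y * x) + (y * x - x * y) := by abel
    rw [e]
    exact add_mem hy (commutator_mem_liePower_one y x)
  obtain ⟨c, hc⟩ := hN.exists_eq_sub_mul (liePower_isTwoSided hF hN 1)
    (isRightNilpotent_liePower_one hF hN hL) hy hy' hy
  refine ⟨y - c, ?_⟩
  rw [sub_mul]
  linear_combination (norm := abel) hc

end Ideals

/-! ### Transfer along homomorphisms -/

section Hom

variable {F : Type v} [Field F] {A : Type u} [NonUnitalNonAssocRing A] [Module F A]
  {B : Type u} [NonUnitalNonAssocRing B] [Module F B]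

theorem IsNovikov.of_surjective (hN : IsNovikov A) (f : A →ₙₐ[F] B)
    (hf : Function.Surjective f) : IsNovikov B := by
  constructor
  · intro x y z
    obtain ⟨x, rfl⟩ := hf x
    obtain ⟨y, rfl⟩ := hf y
    obtain ⟨z, rfl⟩ := hf z
    simp only [associator_apply, ← map_mul, ← map_sub]
    rw [hN.left_symm]
  · intro x y z
    obtain ⟨x, rfl⟩ := hf x
    obtain ⟨y, rfl⟩ := hf y
    obtain ⟨z, rfl⟩ := hf z
    simp only [← map_mul]
    rw [hN.right_comm]

theorem IsNovikov.of_injective (hN : IsNovikov B) (f : A →ₙₐ[F] B)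
    (hf : Function.Injective f) : IsNovikov A := by
  constructor
  · intro x y z
    apply hf
    simp only [associator_apply, map_mul, map_sub]
    exact hN.left_symm _ _ _
  · intro x y z
    apply hf
    simp only [map_mul]
    exact hN.right_comm _ _ _

theorem IsLieSolvable.of_surjective (hL : IsLieSolvable F A) (f : A →ₙₐ[F] B)
    (hf : Function.Surjective f) : IsLieSolvable F B := by
  obtain ⟨n, hn⟩ := hL
  have key : ∀ k, liePower F B k ≤ (liePower F A k).map (f : A →ₗ[F] B) := by
    intro k
    induction k with
    | zero =>
      intro b _
      obtain ⟨a, rfl⟩ := hf b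
      exact ⟨a, Submodule.mem_top (R := F), rfl⟩
    | succ k ih =>
      refine Submodule.span_le.2 ?_
      rintro _ ⟨a, ha, b, hb, rfl⟩
      obtain ⟨a, ha', rfl⟩ := ih ha
      obtain ⟨b, hb', rfl⟩ := ih hb
      refine ⟨a * b - b * a, commutator_mem_liePower_succ ha' hb', ?_⟩
      change f (a * b - b * a) = f a * f b - f b * f a
      rw [map_sub, map_mul, map_mul]
  refine ⟨n, le_bot_iff.1 ((key n).trans ?_)⟩
  rw [hn, Submodule.map_bot]

theorem IsLieSolvable.of_injective (hL : IsLieSolvable F B) (f : A →ₙₐ[F] B)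
    (hf : Function.Injective f) : IsLieSolvable F A := by
  obtain ⟨n, hn⟩ := hL
  have key : ∀ k, liePower F A k ≤ (liePower F B k).comap (f : A →ₗ[F] B) := by
    intro k
    induction k with
    | zero => exact fun _ _ => Submodule.mem_top (R := F)
    | succ k ih =>
      refine Submodule.span_le.2 ?_
      rintro _ ⟨a, ha, b, hb, rfl⟩
      change f (a * b - b * a) ∈ liePower F B (k + 1)
      rw [map_sub, map_mul, map_mul]
      exact commutator_mem_liePower_succ (show f a ∈ liePower F B k from ih ha)
        (show f b ∈ liePower F B k from ih hb)
  refine ⟨n, (Submodule.eq_bot_iff _).2 fun a ha => hf ?_⟩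
  have := key n ha
  rw [hn] at this
  rw [map_zero]
  exact (Submodule.mem_bot F).1 this

end Hom

/-! ### Irreducible algebras with idempotent heart -/

section Irreducible

variable {F : Type v} [Field F] {B : Type u} [NonUnitalNonAssocRing B] [Module F B]
  [IsScalarTower F B B] [SMulCommClass F B B]

/-- A Lie-solvable subdirectly irreducible Novikov algebra with idempotent heart is commutative. -/
theorem IsIrreducibleWithIdempotentHeart.mul_comm (hF : ringChar F ≠ 2)
    (hB : IsIrreducibleWithIdempotentHeart F B) (hL : IsLieSolvable F B) (a b : B) :
    a * b = b * a := by
  obtain ⟨hN, hS, hI⟩ := hB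
  suffices h : liePower F B 1 = ⊥ by
    have := commutator_mem_liePower_one (F := F) a b
    rw [h] at this
    exact sub_eq_zero.1 ((Submodule.mem_bot F).1 this)
  by_contra hne
  have hle := (liePower_isTwoSided hF hN 1).heart_le hne
  obtain ⟨n, hn⟩ := isRightNilpotent_liePower_one hF hN hL
  -- Idempotence keeps the heart inside every right power of an ideal containing it.
  have key : ∀ k, heart F B ≤ rightPower (liePower F B 1) k := by
    intro k
    induction k with
    | zero => exact hle
    | succ k ih =>
      rw [← hI]
      refine Submodule.span_le.2 ?_
      rintro _ ⟨a, ha, b, hb, rfl⟩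
      exact mul_mem_prodSpan (ih ha) (hle hb)
  exact hS (le_bot_iff.1 (hn ▸ key n))

theorem IsIrreducibleWithIdempotentHeart.exists_not_quasiregular (hF : ringChar F ≠ 2)
    (hB : IsIrreducibleWithIdempotentHeart F B) (hL : IsLieSolvable F B) :
    ∃ e ∈ heart F B, ∀ y : B, e + y ≠ y * e := by
  have comm := hB.mul_comm hF hL
  obtain ⟨hN, hS, hI⟩ := hB
  have assoc : ∀ a b c : B, a * (b * c) = (a * b) * c := fun a b c => by
    rw [comm a (b * c), hN.right_comm, comm b a]
  obtain ⟨h, hh, k, hk, hhk⟩ : ∃ h ∈ heart F B, ∃ k ∈ heart F B, h * k ≠ 0 := by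
    by_contra! hcon
    refine hS (hI.symm.trans (Submodule.span_eq_bot.2 ?_))
    rintro _ ⟨a, ha, b, hb, rfl⟩
    exact hcon a ha b hb
  have two : IsTwoSided ((heart F B).map (LinearMap.mulLeft F h)) := by
    have left : ∀ (a : B) {x : B}, x ∈ (heart F B).map (LinearMap.mulLeft F h) →
        a * x ∈ (heart F B).map (LinearMap.mulLeft F h) := by
      rintro a _ ⟨x, hx, rfl⟩
      refine ⟨a * x, heart_isTwoSided.left a hx, ?_⟩
      simp only [LinearMap.mulLeft_apply]
      rw [assoc, assoc, comm a h]
    exact ⟨left, fun a x hx => comm a x ▸ left a hx⟩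
  have hne : (heart F B).map (LinearMap.mulLeft F h) ≠ ⊥ := fun h0 => by
    have : h * k ∈ (heart F B).map (LinearMap.mulLeft F h) := ⟨k, hk, rfl⟩
    rw [h0] at this
    exact hhk ((Submodule.mem_bot F).1 this)
  -- The nonzero ideal h H contains the heart H, hence h itself, so h = h e. Multiplying e + y = y e
  -- by h then forces h = 0.
  obtain ⟨e, he, hhe⟩ := two.heart_le hne hh
  rw [LinearMap.mulLeft_apply] at hhe
  refine ⟨e, he, fun y hy => hhk ?_⟩
  have h1 := congrArg (h * ·) hy
  simp only [mul_add] at h1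
  rw [assoc h y e, hN.right_comm, hhe, add_eq_right] at h1
  rw [h1, zero_mul]

end Irreducible

/-! ### Equivalence of the two radical properties -/

section Radical

variable {F : Type v} [Field F] {A : Type u} [NonUnitalNonAssocRing A] [Module F A]

/-- A nonzero image of the ideal would contain the heart, including its non-quasiregular element,
yet quasiregularity passes to images. -/
theorem map_eq_zero_of_quasiregular (hF : ringChar F ≠ 2) (hL : IsLieSolvable F A)
    {B : Type u} [NonUnitalNonAssocRing B] [Module F B] [IsScalarTower F B B]
    [SMulCommClass F B B] (f : A →ₙₐ[F] B) (hf : Function.Surjective f)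
    (hB : IsIrreducibleWithIdempotentHeart F B) {I : Submodule F A} (hI : IsTwoSided I)
    (hq : ∀ x ∈ I, ∃ y, x + y = y * x) {x : A} (hx : x ∈ I) : f x = 0 := by
  obtain ⟨e, he, hne⟩ := hB.exists_not_quasiregular hF (hL.of_surjective f hf)
  by_contra hfx
  have two : IsTwoSided (I.map (f : A →ₗ[F] B)) := by
    constructor
    · rintro b _ ⟨i, hi, rfl⟩
      obtain ⟨a, rfl⟩ := hf b
      exact ⟨a * i, hI.left a hi, map_mul f a i⟩
    · rintro b _ ⟨i, hi, rfl⟩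
      obtain ⟨a, rfl⟩ := hf b
      exact ⟨i * a, hI.right a hi, map_mul f i a⟩
  have hb : I.map (f : A →ₗ[F] B) ≠ ⊥ := fun h0 => by
    have : f x ∈ I.map (f : A →ₗ[F] B) := ⟨x, hx, rfl⟩
    rw [h0] at this
    exact hfx ((Submodule.mem_bot F).1 this)
  obtain ⟨i, hi, rfl⟩ := two.heart_le hb he
  obtain ⟨y, hy⟩ := hq i hi
  refine hne (f y) ?_
  change f i + f y = f y * f i
  rw [← map_add, hy, map_mul]

theorem not_surjective_of_map_eq_zero {B : Type u} [NonUnitalNonAssocRing B] [Module F B]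
    (f : A →ₙₐ[F] B) (hB : IsIrreducibleWithIdempotentHeart F B) (h : ∀ x, f x = 0) :
    ¬ Function.Surjective f := fun hf => hB.2.1 <| (Submodule.eq_bot_iff _).2 fun b _ => by
  obtain ⟨a, rfl⟩ := hf b
  exact h a

theorem IsLeftQuasiregular.isAndrunakievichRadical (hF : ringChar F ≠ 2) (hN : IsNovikov A)
    (hL : IsLieSolvable F A) (hq : IsLeftQuasiregular A) : IsAndrunakievichRadical F A :=
  ⟨hN, fun _ _ _ _ _ f hf hB => not_surjective_of_map_eq_zero f hB (fun x =>
    map_eq_zero_of_quasiregular hF hL f hf hB (I := ⊤) ⟨fun _ _ _ => trivial, fun _ _ _ => trivial⟩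
      (fun x _ => hq x) (x := x) trivial) hf⟩

/-- The quotient map as an algebra homomorphism. -/
def AlgIdeal.projHom (I : AlgIdeal F A) : A →ₙₐ[F] I.Quotient :=
  { I.proj with
    map_zero' := map_zero I.proj
    map_mul' := I.proj_mul }

theorem AlgIdeal.proj_eq_zero_iff (I : AlgIdeal F A) (a : A) :
    I.proj a = 0 ↔ a ∈ I.toSubmodule := by
  rw [← map_zero I.proj, I.proj_eq_proj_iff, sub_zero]

theorem exists_maximal_avoiding {W₀ : Submodule F A} (h₀ : IsTwoSided W₀) {x : A} (hx : x ∉ W₀) :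
    ∃ W, W₀ ≤ W ∧ IsTwoSided W ∧ x ∉ W ∧
      ∀ V, IsTwoSided V → W ≤ V → x ∉ V → V = W := by
  obtain ⟨W, hle, hmax⟩ := zorn_le_nonempty₀ {W : Submodule F A | IsTwoSided W ∧ x ∉ W} (by
    intro c hc hchain y hy
    have mem : ∀ {a : A}, a ∈ sSup c ↔ ∃ S ∈ c, a ∈ S := fun {a} =>
      Submodule.mem_sSup_of_directed ⟨y, hy⟩ hchain.directedOn
    refine ⟨sSup c, ⟨⟨fun a z hz => ?_, fun a z hz => ?_⟩, fun hxs => ?_⟩,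
      fun z hz => le_sSup hz⟩
    · obtain ⟨S, hS, hz⟩ := mem.1 hz
      exact mem.2 ⟨S, hS, (hc hS).1.left a hz⟩
    · obtain ⟨S, hS, hz⟩ := mem.1 hz
      exact mem.2 ⟨S, hS, (hc hS).1.right a hz⟩
    · obtain ⟨S, hS, hz⟩ := mem.1 hxs
      exact (hc hS).2 hz) W₀ ⟨h₀, hx⟩
  exact ⟨W, hle, hmax.prop.1, hmax.prop.2, fun V hV hWV hxV =>
    le_antisymm (hmax.2 ⟨hV, hxV⟩ hWV) hWV⟩

/-- Modulo an ideal maximal among those avoiding `x`, when `x` is a right unit modulo it, the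
algebra is its own idempotent heart. -/
theorem quotient_isIrreducibleWithIdempotentHeart (hN : IsNovikov A) {W : Submodule F A}
    (hW : IsTwoSided W) {x : A} (hx : x ∉ W) (hunit : ∀ y, y - y * x ∈ W)
    (hmax : ∀ V, IsTwoSided V → W ≤ V → x ∉ V → V = W) :
    IsIrreducibleWithIdempotentHeart F hW.toAlgIdeal.Quotient := by
  set I := hW.toAlgIdeal
  have hx0 : I.proj x ≠ 0 := fun h => hx ((I.proj_eq_zero_iff x).1 h)
  have heart_top : heart F I.Quotient = ⊤ := by
    refine top_le_iff.1 (le_sInf ?_)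
    rintro _ ⟨N, hN0, rfl⟩
    have hV : IsTwoSided (N.toSubmodule.comap I.proj) :=
      ⟨fun a z hz => N.mul_mem_left (I.proj a) hz, fun a z hz => N.mul_mem_right (I.proj a) hz⟩
    have hWV : W ≤ N.toSubmodule.comap I.proj := fun w hw => by
      rw [Submodule.mem_comap, (I.proj_eq_zero_iff w).2 hw]
      exact zero_mem _
    have hxV : x ∈ N.toSubmodule.comap I.proj := by
      by_contra hxV
      have hVW := hmax _ hV hWV hxV
      refine hN0 ((Submodule.eq_bot_iff _).2 fun b hb => ?_)
      obtain ⟨a, rfl⟩ := I.proj_surjective b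
      have ha : a ∈ N.toSubmodule.comap I.proj := hb
      rw [hVW] at ha
      exact (I.proj_eq_zero_iff a).2 ha
    rintro b -
    obtain ⟨a, rfl⟩ := I.proj_surjective b
    have : a ∈ N.toSubmodule.comap I.proj := by
      rw [← sub_add_cancel a (a * x)]
      exact add_mem (hWV (hunit a)) (hV.left a hxV)
    exact this
  refine ⟨hN.of_surjective I.projHom I.proj_surjective, ?_, ?_⟩
  · intro h
    rw [heart_top] at h
    exact hx0 ((Submodule.mem_bot F).1 (h ▸ Submodule.mem_top))
  · refine le_antisymm (heart_top ▸ le_top) ?_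
    rw [heart_top]
    rintro b -
    obtain ⟨a, rfl⟩ := I.proj_surjective b
    refine Submodule.subset_span ⟨I.proj a, trivial, I.proj x, trivial, ?_⟩
    rw [← I.proj_mul]
    exact (I.proj_eq_proj_iff _ _).2 (hunit a)

variable [IsScalarTower F A A] [SMulCommClass F A A]

/-- The range absorbs right multiplications because these commute with one another; modulo
commutators, left multiplication is right multiplication. -/
theorem range_sup_liePower_one_isTwoSided (hF : ringChar F ≠ 2) (hN : IsNovikov A) (x : A) :
    IsTwoSided (LinearMap.range (LinearMap.id - LinearMap.mulRight F x : A →ₗ[F] A) ⊔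
      liePower F A 1) := by
  set P : A →ₗ[F] A := LinearMap.id - LinearMap.mulRight F x
  have hC := liePower_isTwoSided (A := A) hF hN 1
  have right : ∀ (a : A) {z : A}, z ∈ LinearMap.range P ⊔ liePower F A 1 →
      z * a ∈ LinearMap.range P ⊔ liePower F A 1 := by
    intro a z hz
    obtain ⟨_, ⟨b, rfl⟩, c, hc, rfl⟩ := Submodule.mem_sup.1 hz
    rw [add_mul]
    refine Submodule.add_mem_sup ⟨b * a, ?_⟩ (hC.right a hc)
    change b * a - (b * a) * x = (b - b * x) * a
    rw [sub_mul, hN.right_comm]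
  refine ⟨fun a z hz => ?_, right⟩
  rw [← add_sub_cancel (z * a) (a * z)]
  exact add_mem (right a hz) (Submodule.mem_sup_right (commutator_mem_liePower_one a z))

theorem IsAndrunakievichRadical.isLeftQuasiregular (hF : ringChar F ≠ 2)
    (hL : IsLieSolvable F A) (hA : IsAndrunakievichRadical F A) : IsLeftQuasiregular A := by
  obtain ⟨hN, hA⟩ := hA
  refine isLeftQuasiregular_of_mod_liePower_one hF hN hL fun x => ?_
  by_contra! hcon
  have hx : x ∉ LinearMap.range (LinearMap.id - LinearMap.mulRight F x : A →ₗ[F] A) ⊔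
      liePower F A 1 := by
    intro hx
    obtain ⟨_, ⟨b, rfl⟩, c, hc, h⟩ := Submodule.mem_sup.1 hx
    change (b - b * x) + c = x at h
    -- Writing x = b - b x + c makes -b a quasi-inverse of x modulo commutators.
    refine hcon (-b) ?_
    have e : x + -b - -b * x = c := by
      rw [neg_mul]
      linear_combination (norm := abel) -h
    rwa [e]
  obtain ⟨W, hle, hW, hxW, hmax⟩ :=
    exists_maximal_avoiding (range_sup_liePower_one_isTwoSided hF hN x) hx
  exact hA _ hW.toAlgIdeal.projHom hW.toAlgIdeal.proj_surjective
    (quotient_isIrreducibleWithIdempotentHeart hN hW hxW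
      (fun y => hle (Submodule.mem_sup_left ⟨y, rfl⟩)) hmax)

theorem isLeftQuasiregular_iff_isAndrunakievichRadical (hF : ringChar F ≠ 2) (hN : IsNovikov A)
    (hL : IsLieSolvable F A) : IsLeftQuasiregular A ↔ IsAndrunakievichRadical F A :=
  ⟨fun h => h.isAndrunakievichRadical hF hN hL, fun h => h.isLeftQuasiregular hF hL⟩


end Radical

/-! ### Sums and extensions of left-quasiregular ideals -/

section Sum

variable {F : Type v} [Field F] {A : Type u} [NonUnitalNonAssocRing A] [Module F A]

theorem AlgIdeal.subtype_injective (I : AlgIdeal F A) :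
    Function.Injective (NonUnitalSubalgebraClass.subtype I.toSubalgebra) :=
  Subtype.val_injective

theorem AlgIdeal.isNovikov (I : AlgIdeal F A) (hN : IsNovikov A) : IsNovikov I.toSubalgebra :=
  hN.of_injective (NonUnitalSubalgebraClass.subtype I.toSubalgebra) I.subtype_injective

theorem AlgIdeal.isLieSolvable (I : AlgIdeal F A) (hL : IsLieSolvable F A) :
    IsLieSolvable F I.toSubalgebra :=
  hL.of_injective (NonUnitalSubalgebraClass.subtype I.toSubalgebra) I.subtype_injective

/-- A homomorphism from an ideal onto a subdirectly irreducible algebra with idempotent heart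
kills all left-quasiregular ideals inside it. -/
theorem AlgIdeal.map_eq_zero (hF : ringChar F ≠ 2) (hL : IsLieSolvable F A) (I K : AlgIdeal F A)
    (hq : IsLeftQuasiregular I.toSubalgebra) (hIK : I.toSubmodule ≤ K.toSubmodule)
    {B : Type u} [NonUnitalNonAssocRing B] [Module F B] [IsScalarTower F B B]
    [SMulCommClass F B B] (f : K.toSubalgebra →ₙₐ[F] B) (hf : Function.Surjective f)
    (hB : IsIrreducibleWithIdempotentHeart F B) {x : A} (hx : x ∈ I.toSubmodule) :
    f ⟨x, hIK hx⟩ = 0 := by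
  let I' : Submodule F K.toSubalgebra :=
    I.toSubmodule.comap (NonUnitalSubalgebraClass.subtype K.toSubalgebra : K.toSubalgebra →ₗ[F] A)
  have hI' : IsTwoSided I' :=
    ⟨fun a _ hz => I.mul_mem_left (a : A) hz, fun a _ hz => I.mul_mem_right (a : A) hz⟩
  refine map_eq_zero_of_quasiregular hF (K.isLieSolvable hL) f hf hB hI' ?_ (x := ⟨x, hIK hx⟩) hx
  rintro ⟨z, hzK⟩ hz
  obtain ⟨⟨y, hy⟩, h⟩ := hq ⟨z, hz⟩
  have h' : z + y = y * z := congrArg Subtype.val h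
  exact ⟨⟨y, hIK hy⟩, Subtype.ext h'⟩

theorem AlgIdeal.le_quasiregularRadical (I : AlgIdeal F A)
    (hq : IsLeftQuasiregular I.toSubalgebra) :
    I.toSubmodule ≤ (quasiregularRadical F A).toSubmodule :=
  le_sSup ⟨I, hq, rfl⟩

/-- A map onto an irreducible algebra with idempotent heart kills every summand, so it kills the
sum; no quasi-inverse of a sum has to be computed. -/
theorem quasiregularRadical_isAndrunakievichRadical (hF : ringChar F ≠ 2) (hN : IsNovikov A)
    (hL : IsLieSolvable F A) :
    IsAndrunakievichRadical F (quasiregularRadical F A).toSubalgebra := by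
  refine ⟨AlgIdeal.isNovikov _ hN, fun B _ _ _ _ f hf hB =>
    not_surjective_of_map_eq_zero f hB ?_ hf⟩
  have key : (quasiregularRadical F A).toSubmodule ≤
      (LinearMap.ker (f : (quasiregularRadical F A).toSubalgebra →ₗ[F] B)).map
        (NonUnitalSubalgebraClass.subtype (quasiregularRadical F A).toSubalgebra :
          (quasiregularRadical F A).toSubalgebra →ₗ[F] A) := by
    refine sSup_le ?_
    rintro _ ⟨I, hq, rfl⟩ x hx
    exact ⟨⟨x, I.le_quasiregularRadical hq hx⟩,
      I.map_eq_zero hF hL _ hq (I.le_quasiregularRadical hq) f hf hB hx, rfl⟩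
  rintro ⟨x, hx⟩
  obtain ⟨z, hz, h⟩ := key hx
  have : z = ⟨x, hx⟩ := Subtype.ext h
  rw [← this]
  exact hz

variable [IsScalarTower F A A] [SMulCommClass F A A]

theorem quasiregularRadical_isLeftQuasiregular (hF : ringChar F ≠ 2) (hN : IsNovikov A)
    (hL : IsLieSolvable F A) : IsLeftQuasiregular (quasiregularRadical F A).toSubalgebra :=
  (quasiregularRadical_isAndrunakievichRadical hF hN hL).isLeftQuasiregular hF
    (AlgIdeal.isLieSolvable _ hL)

/-- The preimage of a left-quasiregular ideal under the quotient by a left-quasiregular ideal is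
left-quasiregular. -/
theorem AlgIdeal.isLeftQuasiregular_of_quotient (hF : ringChar F ≠ 2) (hN : IsNovikov A)
    (hL : IsLieSolvable F A) (J K : AlgIdeal F A) (hJ : IsLeftQuasiregular J.toSubalgebra)
    (L : AlgIdeal F J.Quotient) (hq : IsLeftQuasiregular L.toSubalgebra)
    (hK : ∀ a, a ∈ K.toSubmodule ↔ J.proj a ∈ L.toSubmodule) :
    IsLeftQuasiregular K.toSubalgebra := by
  have hJK : J.toSubmodule ≤ K.toSubmodule := fun a ha => by
    rw [hK, (J.proj_eq_zero_iff a).2 ha]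
    exact zero_mem _
  refine IsAndrunakievichRadical.isLeftQuasiregular hF (K.isLieSolvable hL)
    ⟨K.isNovikov hN, fun B _ _ _ _ f hf hB => ?_⟩
  obtain ⟨e, -, he⟩ :=
    hB.exists_not_quasiregular hF ((K.isLieSolvable hL).of_surjective f hf)
  obtain ⟨⟨x, hx⟩, rfl⟩ := hf e
  obtain ⟨⟨y, hy⟩, h⟩ := hq ⟨J.proj x, (hK x).1 hx⟩
  obtain ⟨y, rfl⟩ := J.proj_surjective y
  have hyK : y ∈ K.toSubmodule := (hK y).2 hy
  have h' : J.proj (x + y) = J.proj (y * x) := by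
    rw [map_add, J.proj_mul]
    exact congrArg Subtype.val h
  have hmem := (J.proj_eq_proj_iff _ _).1 h'
  -- The defect of y as a quasi-inverse of x lies in J, which f kills; so f x would be quasiregular
  -- after all.
  have h0 := J.map_eq_zero hF hL K hJ hJK f hf hB hmem
  refine he (f ⟨y, hyK⟩) ?_
  have e : (⟨x + y - y * x, hJK hmem⟩ : K.toSubalgebra) =
      ⟨x, hx⟩ + ⟨y, hyK⟩ - ⟨y, hyK⟩ * ⟨x, hx⟩ := rfl
  rw [e, map_sub, map_add, map_mul] at h0
  exact sub_eq_zero.1 h0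

theorem eq_bot_of_quotient_quasiregularRadical (hF : ringChar F ≠ 2) (hN : IsNovikov A)
    (hL : IsLieSolvable F A) (L : AlgIdeal F (quasiregularRadical F A).Quotient)
    (hq : IsLeftQuasiregular L.toSubalgebra) : L.toSubmodule = ⊥ := by
  have hK : IsTwoSided (L.toSubmodule.comap (quasiregularRadical F A).proj) :=
    ⟨fun a _ hz => L.mul_mem_left ((quasiregularRadical F A).proj a) hz, fun a _ hz => L.mul_mem_right ((quasiregularRadical F A).proj a) hz⟩
  have hle := hK.toAlgIdeal.le_quasiregularRadical
    (AlgIdeal.isLeftQuasiregular_of_quotient hF hN hL _ _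
      (quasiregularRadical_isLeftQuasiregular hF hN hL) L hq fun _ => Iff.rfl)
  refine (Submodule.eq_bot_iff _).2 fun b hb => ?_
  obtain ⟨a, rfl⟩ := (quasiregularRadical F A).proj_surjective b
  exact ((quasiregularRadical F A).proj_eq_zero_iff a).2 (hle hb)

end Sum

end NovikovRadicals

open NovikovRadicals in
theorem theorem3 {F : Type v} [Field F] (hF : ringChar F ≠ 2)
    {A : Type u} [NonUnitalNonAssocRing A] [Module F A] [IsScalarTower F A A]
    [SMulCommClass F A A] (hN : IsNovikov A) (hL : IsLieSolvable F A) :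
    (IsLeftQuasiregular A ↔ IsAndrunakievichRadical F A) ∧
    -- the sum `J` of all left-quasiregular ideals is left-quasiregular
    IsLeftQuasiregular (quasiregularRadical F A).toSubalgebra ∧
    -- the quotient `A / J` has no nonzero left-quasiregular ideal
    (∀ L : AlgIdeal F (quasiregularRadical F A).Quotient,
      IsLeftQuasiregular L.toSubalgebra → L.toSubmodule = ⊥) ∧
    -- `J` is the largest Andrunakievich-radical ideal
    IsAndrunakievichRadical F (quasiregularRadical F A).toSubalgebra ∧
    (∀ I : AlgIdeal F A, IsAndrunakievichRadical F I.toSubalgebra →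
      I.toSubmodule ≤ (quasiregularRadical F A).toSubmodule) := by
  have hq := quasiregularRadical_isLeftQuasiregular hF hN hL
  exact ⟨isLeftQuasiregular_iff_isAndrunakievichRadical hF hN hL, hq,
    eq_bot_of_quotient_quasiregularRadical hF hN hL,
    quasiregularRadical_isAndrunakievichRadical hF hN hL,
    fun I hI => I.le_quasiregularRadical (hI.isLeftQuasiregular hF (I.isLieSolvable hL))⟩
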